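/- Let $d\in\mathbb N$, let $\mathcal P_2(\mathbb R^d)$ be the set of Borel probability measures on $\mathbb R^d$ with finite second moment, and let $$W_2(\mu,\nu)=\inf_{\alpha\in\Gamma(\mu,\nu)}\|x-y\|_{L^2(\mathbb R^d\times\mathbb R^d,\alpha)},$$ where $\Gamma(\mu,\nu)$ is the set of couplings, i.e. of Borel probability measures on $\mathbb R^d\times\mathbb R^d$ with marginals $\mu$ and $\nu$; let $\Gamma_o(\mu,\nu)$ be the set of optimal couplings, i.e. of the minimizers. Let $\mu_0,\mu_1\in\mathcal P_2(\mathbb R^d)$ and $\alpha\in\Gamma(\mu_0,\mu_1)$. For $t\in[0,1]$ put $e_t(x,y)=(1-t)x+ty$ and $\mu_t=e_{t,\sharp}\alpha$. Let $v:[0,1]\times\mathbb R^d\to\mathbb R^d$, $v_t=v(t,\cdot)$, be a Borel measurable vector field induced by $\alpha$, that is, for a.e. $t\in[0,1]$, $v_t\in L^1(\mathbb R^d,\mu_t)$ and $$v_t\,\mu_t=e_{t,\sharp}[(y-x)\alpha]$$ as $\mathbb R^d$-valued measures. Then the following holds. i) $t\mapsto\mu_t$ is a narrowly continuous curve in $\mathcal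 P_2(\mathbb R^d)$, and $(\mu_t,v_t)$ satisfies the continuity equation $\partial_t\mu_t+\nabla_x\cdot(\mu_tv_t)=0$ in the sense of distributions, i.e. $$\int_0^1\int_{\mathbb R^d}\partial_t\varphi+\langle\nabla_x\varphi,v_t\rangle\,\mathrm d\mu_t\,\mathrm dt=0\qquad\text{for all }\varphi\in C_c^\infty((0,1)\times\mathbb R^d),$$ with an absolutely convergent integral. Moreover $$\|v_t\|_{L^2(\mathbb R^d,\mu_t)}\le\|y-x\|_{L^2(\mathbb R^d\times\mathbb R^d,\alpha)}<\infty\qquad\text{for a.e. }t\in[0,1].$$ In particular $t\mapsto\|v_t\|_{L^2(\mathbb R^d,\mu_t)}$ is in $L^1([0,1])$, and $t\mapsto\mu_t$ is absolutely continuous in $(\mathcal P_2(\mathbb R^d),W_2)$: there is $m\in L^1([0,1])$ with $W_2(\mu_s,\mu_t)\le\int_s^tm(r)\,\mathrm dr$ for all $0\le s\le t\le1$. ii) If $\alpha\in\Gamma_o(\mu_0,\mu_1)$, then $W_2(\mu_t,\mu_{t+h})=h\,W_2(\mu_0,\mu_1)$ for all $t,h\ge0$ with $t+h\le1$, and for a.e.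 $t\in[0,1]$ the metric derivative $|\mu_t'|=\lim_{h\to0}W_2(\mu_t,\mu_{t+h})/|h|$ exists and $$|\mu'_t|=W_2(\mu_0,\mu_1)=\|v_t\|_{L^2(\mathbb R^d,\mu_t)}.$$ -/

import Mathlib

open MeasureTheory Set Filter Topology
open scoped ENNReal ContDiff

/-- The Euclidean space `ℝ^d`. -/
abbrev Rd (d : ℕ) : Type := EuclideanSpace ℝ (Fin d)

/-- `μ ∈ P₂(ℝ^d)`: a Borel probability measure with finite second moment. -/
structure IsP2 {d : ℕ} (μ : Measure (Rd d)) : Prop where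
  isProbabilityMeasure : IsProbabilityMeasure μ
  secondMoment : ∫⁻ x, ‖x‖ₑ ^ 2 ∂μ < ⊤

/-- `Γ(μ, ν)`: the couplings (plans) with marginals `μ` and `ν`. -/
def couplings {d : ℕ} (μ ν : Measure (Rd d)) : Set (Measure (Rd d × Rd d)) :=
  {α | IsProbabilityMeasure α ∧ α.map Prod.fst = μ ∧ α.map Prod.snd = ν}

/-- The transport cost `‖x - y‖_{L²(α)}` of a plan `α`, with values in `[0, ∞]`. -/
noncomputable def planCost {d : ℕ} (α : Measure (Rd d × Rd d)) : ℝ≥0∞ :=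
  eLpNorm (fun p : Rd d × Rd d => p.1 - p.2) 2 α

/-- The Wasserstein-2 distance; for `μ, ν ∈ P₂(ℝ^d)` the infimum is finite. -/
noncomputable def W2 {d : ℕ} (μ ν : Measure (Rd d)) : ℝ :=
  (⨅ α ∈ couplings μ ν, planCost α).toReal

/-- `Γ_o(μ, ν)`: the optimal plans, i.e. the couplings of least transport cost. -/
def optimalPlans {d : ℕ} (μ ν : Measure (Rd d)) : Set (Measure (Rd d × Rd d)) :=
  {α | α ∈ couplings μ ν ∧ ∀ β ∈ couplings μ ν, planCost α ≤ planCost β}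

/-- The map `e_t(x, y) = (1 - t) x + t y`. -/
def interp {d : ℕ} (t : ℝ) (p : Rd d × Rd d) : Rd d :=
  (1 - t) • p.1 + t • p.2

/-- The curve `μ_t = (e_t)_♯ α` induced by a plan `α`. -/
noncomputable def inducedCurve {d : ℕ} (α : Measure (Rd d × Rd d)) (t : ℝ) : Measure (Rd d) :=
  α.map (interp t)

/-- `v` is Borel measurable as a vector field on `[a, b] × ℝ^d`. -/
def MeasurableField {d : ℕ} (a b : ℝ) (v : ℝ → Rd d → Rd d) : Prop :=
  Measurable fun p : Icc a b × Rd d => v p.1 p.2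

/-- `v` is a velocity field induced by the plan `α`: it is Borel measurable on `[0, 1] × ℝ^d` and,
for a.e. `t ∈ [0, 1]`, `v_t μ_t = (e_t)_♯ [(y - x) α]` as `ℝ^d`-valued measures (the left-hand side
being defined means that `v_t ∈ L¹(μ_t)`). -/
structure IsInducedVelocity {d : ℕ} (α : Measure (Rd d × Rd d)) (v : ℝ → Rd d → Rd d) : Prop where
  measurable : MeasurableField 0 1 v
  integrable : ∀ᵐ t ∂volume.restrict (Icc (0 : ℝ) 1), Integrable (v t) (inducedCurve α t)
  density_eq : ∀ᵐ t ∂volume.restrict (Icc (0 : ℝ) 1),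
    (inducedCurve α t).withDensityᵥ (v t) =
      (α.withDensityᵥ fun p : Rd d × Rd d => p.2 - p.1).map (interp t)

/-- Narrow continuity of the curve `μ` on `[a, b]`. -/
def NarrowlyContinuous {d : ℕ} (a b : ℝ) (μ : ℝ → Measure (Rd d)) : Prop :=
  ∀ f : BoundedContinuousFunction (Rd d) ℝ, ContinuousOn (fun t => ∫ x, f x ∂μ t) (Icc a b)

/-- `φ ∈ C_c^∞((a, b) × ℝ^d)`. -/
structure IsTestFunction {d : ℕ} (a b : ℝ) (φ : ℝ × Rd d → ℝ) : Prop where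
  contDiff : ContDiff ℝ ∞ φ
  hasCompactSupport : HasCompactSupport φ
  tsupport_subset : tsupport φ ⊆ Ioo a b ×ˢ univ

/-- The integrand `∂_t φ + ⟨∇_x φ, v_t⟩` of the continuity equation. -/
noncomputable def ceIntegrand {d : ℕ} (v : ℝ → Rd d → Rd d) (φ : ℝ × Rd d → ℝ)
    (t : ℝ) (x : Rd d) : ℝ :=
  deriv (fun s => φ (s, x)) t + inner ℝ (gradient (fun z => φ (t, z)) x) (v t x)

/-- `(μ_t, v_t)`, a narrowly continuous curve in `P₂(ℝ^d)` with a Borel measurable vector field,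
satisfies `∂_t μ_t + ∇_x · (μ_t v_t) = 0` in the sense of distributions on `(a, b) × ℝ^d`.
The double integral is required to converge absolutely. -/
structure SatisfiesCE {d : ℕ} (a b : ℝ) (μ : ℝ → Measure (Rd d)) (v : ℝ → Rd d → Rd d) :
    Prop where
  isP2 : ∀ t ∈ Icc a b, IsP2 (μ t)
  narrowlyContinuous : NarrowlyContinuous a b μ
  measurable : MeasurableField a b v
  integrable_inner : ∀ φ, IsTestFunction a b φ →
    ∀ᵐ t ∂volume.restrict (Icc a b), Integrable (ceIntegrand v φ t) (μ t)
  integrable_outer : ∀ φ, IsTestFunction a b φ →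
    IntegrableOn (fun t => ∫ x, ‖ceIntegrand v φ t x‖ ∂μ t) (Icc a b)
  integral_eq_zero : ∀ φ, IsTestFunction a b φ →
    ∫ t in Icc a b, ∫ x, ceIntegrand v φ t x ∂μ t = 0

/-- `μ : [a, b] → P₂(ℝ^d)` is an absolutely continuous curve with respect to `W₂`. -/
structure IsACCurve {d : ℕ} (a b : ℝ) (μ : ℝ → Measure (Rd d)) : Prop where
  isP2 : ∀ t ∈ Icc a b, IsP2 (μ t)
  exists_bound : ∃ m : ℝ → ℝ, IntegrableOn m (Icc a b) ∧
    ∀ s ∈ Icc a b, ∀ t ∈ Icc a b, s ≤ t → W2 (μ s) (μ t) ≤ ∫ r in s..t, m r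

/-- The curve `μ` on `[a, b]` has metric derivative `L` at `t`:
`W₂(μ_t, μ_{t+h}) / |h| → L` as `h → 0` with `h ≠ 0` and `t + h ∈ [a, b]`. -/
def HasMetricDeriv {d : ℕ} (a b : ℝ) (μ : ℝ → Measure (Rd d)) (t L : ℝ) : Prop :=
  Tendsto (fun h => W2 (μ t) (μ (t + h)) / |h|) (𝓝[{h | h ≠ 0 ∧ t + h ∈ Icc a b}] 0) (𝓝 L)

/-! Write w = y - x. Along the segment t ↦ e_t(x, y) a test function φ has derivative ∂_tφ + ⟨∇φ,
w⟩. Under the integral, the identity v_t μ_t = e_{t,♯}(wα) replaces w by v_t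
(`integral_inner_density`), so Fubini and the fundamental theorem of calculus on each segment give
the continuity equation.

Disintegrating α over e_t shows that v_t is the fibrewise mean of w (`ae_eq_integral_condKernel`).
Two copies of α that are conditionally independent given e_t, with displacements w₁ and w₂,
therefore satisfy ‖v_t‖² = E⟨w₁, w₂⟩ (`exists_conditionally_independent_copies`). Bounding the inner
product by (|w₁|² + |w₂|²)/2 yields ‖v_t‖ ≤ ‖w‖ (`memLp_density`).

If α is optimal, joining the start x₁ of the first copy to the end y₂ of the second gives a
competitor. The two segments meet at time t, so y₂ - x₁ = t w₁ + (1-t) w₂. Comparing costs gives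
‖w‖² ≤ (t² + (1-t)²)‖w‖² + 2t(1-t)‖v_t‖², that is ‖w‖ ≤ ‖v_t‖ for 0 < t < 1
(`integral_norm_sq_velocity_of_optimal`). Injectivity of e_t on the support of α is not needed.

For the distances, (e_s, e_t)_♯ α is a plan of cost |t-s|‖w‖, and for optimal α the triangle
inequality turns this bound into an equality. -/

open ProbabilityTheory

/-! ### Gluing of plans -/

section Gluing

variable {B A C : Type*} [MeasurableSpace B] [MeasurableSpace A] [MeasurableSpace C]
  [StandardBorelSpace A] [Nonempty A] [StandardBorelSpace C] [Nonempty C]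

/-- The gluing of two plans along their common first marginal, conditionally independent over it. -/
noncomputable def gluing (ρ : Measure (B × A)) (σ : Measure (B × C))
    [IsFiniteMeasure ρ] [IsFiniteMeasure σ] : Measure (B × (A × C)) :=
  ρ.fst ⊗ₘ (ρ.condKernel ×ₖ σ.condKernel)

variable (ρ : Measure (B × A)) (σ : Measure (B × C))

instance [IsProbabilityMeasure ρ] [IsProbabilityMeasure σ] : IsProbabilityMeasure (gluing ρ σ) := by
  unfold gluing; infer_instance

theorem map_gluing_left [IsProbabilityMeasure ρ] [IsProbabilityMeasure σ] :
    (gluing ρ σ).map (Prod.map id Prod.fst) = ρ := by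
  rw [gluing, ← Measure.compProd_map measurable_fst]
  rw [← Kernel.fst_eq, Kernel.fst_prod, ρ.disintegrate]

theorem map_gluing_right [IsProbabilityMeasure ρ] [IsProbabilityMeasure σ] (h : ρ.fst = σ.fst) :
    (gluing ρ σ).map (Prod.map id Prod.snd) = σ := by
  rw [gluing, ← Measure.compProd_map measurable_snd]
  rw [← Kernel.snd_eq, Kernel.snd_prod, h, σ.disintegrate]

end Gluing

/-! ### Conditional means and conditionally independent copies -/

section Disintegration

variable {B Ω : Type*} [MeasurableSpace B] [MeasurableSpace Ω] {α : Measure Ω} {e : Ω → B}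

theorem MeasureTheory.MemLp.integrable_real_inner {F : Type*} [NormedAddCommGroup F]
    [InnerProductSpace ℝ F] {f g : Ω → F} (hf : MemLp f 2 α) (hg : MemLp g 2 α) :
    Integrable (fun p => (inner ℝ (f p) (g p) : ℝ)) α :=
  (hf.norm.integrable_mul hg.norm).mono (hf.1.inner hg.1) <| ae_of_all _ fun _ =>
    (norm_inner_le_norm _ _).trans (le_abs_self _)

/-- The law of (e(p), p) makes conditioning on e a disintegration over the first coordinate, so
`condKernel` applies without any structure on the base space. -/
theorem isProbabilityMeasure_graph [IsProbabilityMeasure α] (he : Measurable e) :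
    IsProbabilityMeasure (α.map fun p => (e p, p)) :=
  Measure.isProbabilityMeasure_map (he.prodMk measurable_id).aemeasurable

theorem fst_graph (he : Measurable e) : (α.map fun p => (e p, p)).fst = α.map e := by
  rw [Measure.fst, Measure.map_map measurable_fst (by fun_prop)]; rfl

theorem snd_graph (he : Measurable e) : (α.map fun p => (e p, p)).map Prod.snd = α := by
  rw [Measure.map_map measurable_snd (by fun_prop)]
  exact Measure.map_id

theorem integrable_snd_graph {F : Type*} [NormedAddCommGroup F] {w : Ω → F} (he : Measurable e) (hw : Integrable w α) :
    Integrable (fun q : B × Ω => w q.2) (α.map fun p => (e p, p)) := by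
  have h := snd_graph (α := α) he
  rw [← h] at hw
  exact hw.comp_measurable measurable_snd

variable {F : Type*} [NormedAddCommGroup F] [InnerProductSpace ℝ F] [CompleteSpace F]
  [StandardBorelSpace Ω] [Nonempty Ω] [IsProbabilityMeasure α] {w : Ω → F} {v : B → F}

/-- A density of `e_♯ (w α)` with respect to `e_♯ α` is the fibrewise mean of `w`. -/
theorem ae_eq_integral_condKernel (he : Measurable e) (hw : Integrable w α)
    (hv : Integrable v (α.map e))
    (h : ∀ s, MeasurableSet s → ∫ z in s, v z ∂α.map e = ∫ p in e ⁻¹' s, w p ∂α) :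
    haveI := isProbabilityMeasure_graph (α := α) he
    v =ᵐ[α.map e] fun z => ∫ p, w p ∂(α.map fun p => (e p, p)).condKernel z := by
  have := isProbabilityMeasure_graph (α := α) he
  have hi := integrable_snd_graph he hw
  have hgr : Measurable fun p => (e p, p) := he.prodMk measurable_id
  have hm := hi.integral_condKernel
  rw [fst_graph he] at hm
  refine Integrable.ae_eq_of_forall_setIntegral_eq _ _ hv hm fun s hs _ => ?_
  have h2 := Measure.setIntegral_condKernel_univ_right hs hi.integrableOn
  rw [fst_graph he] at h2
  rw [h s hs, h2, setIntegral_map (hs.prod MeasurableSet.univ) hi.aestronglyMeasurable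
    hgr.aemeasurable]
  congr 2
  ext p; simp

/-- The weak form of `v (e_♯ α) = e_♯ (w α)`, tested against bounded fields. -/
theorem integral_inner_density (he : Measurable e) (hw : Integrable w α)
    (hv : Integrable v (α.map e))
    (h : ∀ s, MeasurableSet s → ∫ z in s, v z ∂α.map e = ∫ p in e ⁻¹' s, w p ∂α)
    {g : B → F} (hg : StronglyMeasurable g) {K : ℝ} (hK : ∀ z, ‖g z‖ ≤ K) :
    ∫ z, inner ℝ (g z) (v z) ∂α.map e = ∫ p, inner ℝ (g (e p)) (w p) ∂α := by
  have := isProbabilityMeasure_graph (α := α) he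
  have hi := integrable_snd_graph he hw
  have hgr : Measurable fun p => (e p, p) := he.prodMk measurable_id
  have hint : Integrable (fun q : B × Ω => (inner ℝ (g q.1) (w q.2) : ℝ))
      (α.map fun p => (e p, p)) := by
    refine (hi.norm.const_mul K).mono
      ((hg.comp_measurable measurable_fst).aestronglyMeasurable.inner hi.1) (ae_of_all _ fun q => ?_)
    refine (norm_inner_le_norm _ _).trans ?_
    refine le_trans ?_ (le_abs_self _)
    exact mul_le_mul_of_nonneg_right (hK _) (norm_nonneg _)
  -- On the fibre over z the factor g(e(p)) is the constant g(z), so it leaves the inner integral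
  -- and only the mean of w remains.
  have h1 := Measure.integral_condKernel hint
  rw [fst_graph he, integral_map hgr.aemeasurable hint.1] at h1
  rw [← h1]
  have hae := hi.condKernel_ae
  rw [fst_graph he] at hae
  refine integral_congr_ae ?_
  filter_upwards [ae_eq_integral_condKernel he hw hv h, hae] with z hz hz2
  rw [hz]
  exact (integral_inner hz2 (g z)).symm

/-- Two copies of `α` that are conditionally independent given `e`. -/
theorem exists_conditionally_independent_copies [MeasurableEq B] (he : Measurable e)
    (hw : MemLp w 2 α) (hv : Integrable v (α.map e))
    (h : ∀ s, MeasurableSet s → ∫ z in s, v z ∂α.map e = ∫ p in e ⁻¹' s, w p ∂α) :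
    ∃ γ : Measure (Ω × Ω), IsProbabilityMeasure γ ∧ γ.map Prod.fst = α ∧ γ.map Prod.snd = α ∧
      (∀ᵐ q ∂γ, e q.1 = e q.2) ∧ Integrable (fun z => ‖v z‖ ^ 2) (α.map e) ∧
      ∫ q, inner ℝ (w q.1) (w q.2) ∂γ = ∫ z, ‖v z‖ ^ 2 ∂α.map e := by
  have := isProbabilityMeasure_graph (α := α) he
  have hgr : Measurable fun p => (e p, p) := he.prodMk measurable_id
  set ρ := α.map fun p => (e p, p) with hρ
  have hleft := map_gluing_left ρ ρ
  have hright := map_gluing_right ρ ρ rfl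
  have hgraph : ∀ᵐ q ∂ρ, e q.2 = q.1 := by
    rw [hρ, ae_map_iff hgr.aemeasurable (measurableSet_eq_fun (by fun_prop) (by fun_prop))]
    simp
  have hm1 : Measurable (Prod.map id Prod.fst : B × Ω × Ω → B × Ω) := by fun_prop
  have hm2 : Measurable (Prod.map id Prod.snd : B × Ω × Ω → B × Ω) := by fun_prop
  have hf : ((gluing ρ ρ).map Prod.snd).map Prod.fst = α := by
    conv_rhs => rw [← snd_graph (α := α) he, ← hρ, ← hleft]
    rw [Measure.map_map measurable_fst measurable_snd, Measure.map_map measurable_snd hm1]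
    rfl
  have hs : ((gluing ρ ρ).map Prod.snd).map Prod.snd = α := by
    conv_rhs => rw [← snd_graph (α := α) he, ← hρ, ← hright]
    rw [Measure.map_map measurable_snd measurable_snd, Measure.map_map measurable_snd hm2]
    rfl
  have hw1 : MemLp (fun q : Ω × Ω => w q.1) 2 ((gluing ρ ρ).map Prod.snd) :=
    MemLp.comp_of_map (hf.symm ▸ hw) measurable_fst.aemeasurable
  have hw2 : MemLp (fun q : Ω × Ω => w q.2) 2 ((gluing ρ ρ).map Prod.snd) :=
    MemLp.comp_of_map (hs.symm ▸ hw) measurable_snd.aemeasurable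
  have hin : Integrable (fun q : Ω × Ω => (inner ℝ (w q.1) (w q.2) : ℝ))
      ((gluing ρ ρ).map Prod.snd) := hw1.integrable_real_inner hw2
  have hin' := hin.comp_measurable measurable_snd
  -- By independence on each fibre, the mean of the inner product is the inner product of the means.
  have hae : (fun z => ∫ q : Ω × Ω, inner ℝ (w q.1) (w q.2) ∂(ρ.condKernel ×ₖ ρ.condKernel) z)
      =ᵐ[α.map e] fun z => ‖v z‖ ^ 2 := by
    have hi := (integrable_snd_graph he (hw.integrable (by norm_num))).condKernel_ae
    rw [fst_graph he] at hi
    filter_upwards [ae_eq_integral_condKernel he (hw.integrable (by norm_num)) hv h, hi]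
      with z hz hi
    rw [hz, Kernel.prod_apply, ← real_inner_self_eq_norm_sq]
    exact integral_prod_bilin (innerSL ℝ) hi hi
  refine ⟨(gluing ρ ρ).map Prod.snd, Measure.isProbabilityMeasure_map (by fun_prop), hf, hs, ?_,
    ?_, ?_⟩
  · rw [ae_map_iff measurable_snd.aemeasurable (measurableSet_eq_fun (by fun_prop) (by fun_prop))]
    have h1 : ∀ᵐ q ∂gluing ρ ρ, e q.2.1 = q.1 := by
      rw [← hleft] at hgraph
      exact ae_of_ae_map hm1.aemeasurable hgraph
    have h2 : ∀ᵐ q ∂gluing ρ ρ, e q.2.2 = q.1 := by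
      rw [← hright] at hgraph
      exact ae_of_ae_map hm2.aemeasurable hgraph
    filter_upwards [h1, h2] with q hq1 hq2
    rw [hq1, hq2]
  · refine Integrable.congr ?_ hae
    rw [← fst_graph he]
    -- The composition of a measure with a kernel is read as a composition of kernels out of `Unit`.
    exact Integrable.integral_compProd (κ := Kernel.const Unit ρ.fst) (a := ())
      (η := Kernel.prodMkLeft Unit (ρ.condKernel ×ₖ ρ.condKernel)) hin'
  · rw [integral_map (by fun_prop) hin.1, ← integral_congr_ae hae, ← fst_graph he]
    exact Measure.integral_compProd hin'

end Disintegration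

/-! ### The extended Wasserstein distance -/

section Wasserstein

variable {d : ℕ}

/-- The Wasserstein-2 distance with values in `[0, ∞]`. -/
noncomputable def W2e (μ ν : Measure (Rd d)) : ℝ≥0∞ := ⨅ α ∈ couplings μ ν, planCost α

theorem W2_eq_toReal_W2e (μ ν : Measure (Rd d)) : W2 μ ν = (W2e μ ν).toReal := rfl

theorem W2e_le_planCost {μ ν : Measure (Rd d)} {α : Measure (Rd d × Rd d)}
    (h : α ∈ couplings μ ν) : W2e μ ν ≤ planCost α := iInf₂_le α h

theorem swap_mem_couplings {μ ν : Measure (Rd d)} {α : Measure (Rd d × Rd d)}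
    (h : α ∈ couplings μ ν) : α.map Prod.swap ∈ couplings ν μ := by
  obtain ⟨h0, h1, h2⟩ := h
  refine ⟨Measure.isProbabilityMeasure_map (by fun_prop), ?_, ?_⟩
  · rw [Measure.map_map measurable_fst measurable_swap]; exact h2
  · rw [Measure.map_map measurable_snd measurable_swap]; exact h1

theorem planCost_map {Ω : Type*} [MeasurableSpace Ω] {β : Measure Ω} {f : Ω → Rd d × Rd d}
    (hf : Measurable f) :
    planCost (β.map f) = eLpNorm (fun p => (f p).1 - (f p).2) 2 β := by
  rw [planCost, eLpNorm_map_measure (Measurable.aestronglyMeasurable (by fun_prop)) hf.aemeasurable]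
  rfl

theorem W2e_comm (μ ν : Measure (Rd d)) : W2e μ ν = W2e ν μ := by
  have key : ∀ μ ν : Measure (Rd d), W2e μ ν ≤ W2e ν μ := fun μ ν => by
    refine le_iInf₂ fun α hα => (W2e_le_planCost (swap_mem_couplings hα)).trans_eq ?_
    rw [planCost_map measurable_swap, planCost, ← eLpNorm_neg]
    congr 1
    ext1 p
    simp
  exact le_antisymm (key _ _) (key _ _)

/-- Gluing a plan from μ to ν and one from ν to ρ along ν, then forgetting the middle point, gives a
plan from μ to ρ; Minkowski's inequality in L² bounds its cost. The first plan is swapped so that ν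
becomes its first marginal. -/
theorem W2e_triangle (μ ν ρ : Measure (Rd d)) : W2e μ ρ ≤ W2e μ ν + W2e ν ρ := by
  simp_rw [W2e, ENNReal.iInf_add, ENNReal.add_iInf]
  refine le_iInf₂ fun α hα => le_iInf₂ fun β hβ => ?_
  obtain ⟨hα', -, hα2⟩ := swap_mem_couplings hα
  obtain ⟨hβ0, hβ1, hβ2⟩ := hβ
  set α' := α.map Prod.swap with hα'_def
  have hmarg : α'.fst = β.fst := by
    rw [Measure.fst, Measure.fst, hβ1, (swap_mem_couplings hα).2.1]
  have hl := map_gluing_left α' β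
  have hr := map_gluing_right α' β hmarg
  set γ := gluing α' β
  have hm1 : Measurable (Prod.map id Prod.fst : Rd d × Rd d × Rd d → Rd d × Rd d) := by fun_prop
  have hm2 : Measurable (Prod.map id Prod.snd : Rd d × Rd d × Rd d → Rd d × Rd d) := by fun_prop
  have hc : γ.map Prod.snd ∈ couplings μ ρ := by
    refine ⟨Measure.isProbabilityMeasure_map (by fun_prop), ?_, ?_⟩
    · rw [Measure.map_map measurable_fst measurable_snd, ← hα2, ← hl,
        Measure.map_map measurable_snd hm1]
      rfl
    · rw [Measure.map_map measurable_snd measurable_snd, ← hβ2, ← hr,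
        Measure.map_map measurable_snd hm2]
      rfl
  have e1 : planCost α = eLpNorm (fun q : Rd d × Rd d × Rd d => q.2.1 - q.1) 2 γ := by
    have : α = γ.map fun q : Rd d × Rd d × Rd d => (q.2.1, q.1) := by
      have h : α = α'.map Prod.swap := by
        rw [hα'_def, Measure.map_map measurable_swap measurable_swap]; simp
      rw [h, ← hl, Measure.map_map measurable_swap hm1]
      rfl
    rw [this, planCost_map (by fun_prop)]
  have e2 : planCost β = eLpNorm (fun q : Rd d × Rd d × Rd d => q.1 - q.2.2) 2 γ := by
    rw [← hr, planCost_map hm2]; rfl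
  refine (W2e_le_planCost hc).trans ?_
  rw [planCost_map measurable_snd, e1, e2]
  refine le_trans (le_of_eq ?_) (eLpNorm_add_le (Measurable.aestronglyMeasurable (by fun_prop))
    (Measurable.aestronglyMeasurable (by fun_prop)) one_le_two)
  congr 1
  ext1 q
  simp

end Wasserstein

/-! ### Displacement interpolation: moments, distances, narrow continuity -/

section InducedCurve

variable {d : ℕ} {μ₀ μ₁ : Measure (Rd d)} {α : Measure (Rd d × Rd d)}

theorem continuous_uncurry_interp :
    Continuous fun q : ℝ × (Rd d × Rd d) => interp q.1 q.2 := by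
  unfold interp; fun_prop

theorem continuous_interp (t : ℝ) : Continuous (interp (d := d) t) :=
  continuous_uncurry_interp.comp (Continuous.prodMk_right t)

theorem measurable_interp (t : ℝ) : Measurable (interp (d := d) t) := (continuous_interp t).measurable

theorem inducedCurve_zero (hα : α ∈ couplings μ₀ μ₁) : inducedCurve α 0 = μ₀ := by
  rw [← hα.2.1, inducedCurve]
  congr 1
  ext1 p
  simp [interp]

theorem inducedCurve_one (hα : α ∈ couplings μ₀ μ₁) : inducedCurve α 1 = μ₁ := by
  rw [← hα.2.2, inducedCurve]
  congr 1
  ext1 p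
  simp [interp]

theorem isP2_iff_memLp {μ : Measure (Rd d)} [IsProbabilityMeasure μ] :
    IsP2 μ ↔ MemLp (fun x => x) 2 μ := by
  have key : eLpNorm (fun x : Rd d => x) 2 μ ^ 2 = ∫⁻ x, ‖x‖ₑ ^ 2 ∂μ := by
    have := eLpNorm_nnreal_pow_eq_lintegral (μ := μ) (f := fun x : Rd d => x) (p := 2) two_ne_zero
    simpa using this
  constructor
  · intro h
    refine ⟨by fun_prop, ?_⟩
    have := h.secondMoment
    rw [← key] at this
    exact (ENNReal.pow_lt_top_iff.1 this).resolve_right two_ne_zero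
  · intro h
    exact ⟨inferInstance, by rw [← key]; exact ENNReal.pow_lt_top h.2⟩

theorem memLp_fst (hμ₀ : IsP2 μ₀) (hα : α ∈ couplings μ₀ μ₁) :
    MemLp (fun p : Rd d × Rd d => p.1) 2 α := by
  have := hμ₀.isProbabilityMeasure
  have h := isP2_iff_memLp.1 hμ₀
  rw [← hα.2.1] at h
  exact h.comp_of_map measurable_fst.aemeasurable

theorem memLp_snd (hμ₁ : IsP2 μ₁) (hα : α ∈ couplings μ₀ μ₁) :
    MemLp (fun p : Rd d × Rd d => p.2) 2 α := by
  have := hμ₁.isProbabilityMeasure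
  have h := isP2_iff_memLp.1 hμ₁
  rw [← hα.2.2] at h
  exact h.comp_of_map measurable_snd.aemeasurable

theorem memLp_displacement (hμ₀ : IsP2 μ₀) (hμ₁ : IsP2 μ₁) (hα : α ∈ couplings μ₀ μ₁) :
    MemLp (fun p : Rd d × Rd d => p.2 - p.1) 2 α :=
  (memLp_snd hμ₁ hα).sub (memLp_fst hμ₀ hα)

theorem isProbabilityMeasure_inducedCurve [IsProbabilityMeasure α] (t : ℝ) :
    IsProbabilityMeasure (inducedCurve α t) :=
  Measure.isProbabilityMeasure_map (measurable_interp t).aemeasurable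

theorem isP2_inducedCurve (hμ₀ : IsP2 μ₀) (hμ₁ : IsP2 μ₁) (hα : α ∈ couplings μ₀ μ₁) (t : ℝ) :
    IsP2 (inducedCurve α t) := by
  have := hα.1
  have := isProbabilityMeasure_inducedCurve (α := α) t
  rw [isP2_iff_memLp, inducedCurve, memLp_map_measure_iff (by fun_prop)
    (measurable_interp t).aemeasurable]
  exact ((memLp_fst hμ₀ hα).const_smul (1 - t)).add ((memLp_snd hμ₁ hα).const_smul t)

theorem planCost_eq_eLpNorm_displacement :
    planCost α = eLpNorm (fun p : Rd d × Rd d => p.2 - p.1) 2 α := by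
  rw [planCost, ← eLpNorm_neg]
  congr 1
  ext1 p
  simp

/-- Moving every particle along its own segment is an admissible plan, and e_s - e_t = (t-s)(x-y).
-/
theorem W2e_inducedCurve_le [IsProbabilityMeasure α] (s t : ℝ) :
    W2e (inducedCurve α s) (inducedCurve α t) ≤ ENNReal.ofReal |t - s| * planCost α := by
  have hm : Measurable fun p : Rd d × Rd d => (interp s p, interp t p) :=
    (measurable_interp s).prodMk (measurable_interp t)
  have hc : α.map (fun p => (interp s p, interp t p)) ∈
      couplings (inducedCurve α s) (inducedCurve α t) := by
    refine ⟨Measure.isProbabilityMeasure_map hm.aemeasurable, ?_, ?_⟩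
    · rw [Measure.map_map measurable_fst hm]; rfl
    · rw [Measure.map_map measurable_snd hm]; rfl
  refine (W2e_le_planCost hc).trans_eq ?_
  rw [planCost_map hm, planCost, ← Real.norm_eq_abs, ofReal_norm, ← eLpNorm_const_smul]
  congr 1
  ext1 p
  simp only [interp, Pi.smul_apply]
  module

theorem planCost_ne_top (hμ₀ : IsP2 μ₀) (hμ₁ : IsP2 μ₁) (hα : α ∈ couplings μ₀ μ₁) :
    planCost α ≠ ⊤ := by
  rw [planCost_eq_eLpNorm_displacement]
  exact (memLp_displacement hμ₀ hμ₁ hα).2.ne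

theorem W2_inducedCurve_le (hμ₀ : IsP2 μ₀) (hμ₁ : IsP2 μ₁) (hα : α ∈ couplings μ₀ μ₁) (s t : ℝ) :
    W2 (inducedCurve α s) (inducedCurve α t) ≤ |t - s| * (planCost α).toReal := by
  have := hα.1
  rw [W2_eq_toReal_W2e, ← ENNReal.toReal_ofReal (abs_nonneg (t - s)), ← ENNReal.toReal_mul]
  exact ENNReal.toReal_mono (ENNReal.mul_ne_top ENNReal.ofReal_ne_top (planCost_ne_top hμ₀ hμ₁ hα))
    (W2e_inducedCurve_le s t)

theorem isACCurve_inducedCurve (hμ₀ : IsP2 μ₀) (hμ₁ : IsP2 μ₁) (hα : α ∈ couplings μ₀ μ₁) :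
    IsACCurve 0 1 (inducedCurve α) := by
  refine ⟨fun t _ => isP2_inducedCurve hμ₀ hμ₁ hα t, fun _ => (planCost α).toReal, by simp, ?_⟩
  intro s _ t _ hst
  refine (W2_inducedCurve_le hμ₀ hμ₁ hα s t).trans_eq ?_
  rw [intervalIntegral.integral_const, abs_of_nonneg (by linarith), smul_eq_mul]

theorem W2e_eq_planCost (hα : α ∈ optimalPlans μ₀ μ₁) : W2e μ₀ μ₁ = planCost α :=
  le_antisymm (W2e_le_planCost hα.1) (le_iInf₂ hα.2)

/-- Finiteness is required because `toReal` sends `⊤` to 0, which could make the right-hand side too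
small. -/
theorem W2_triangle_of_ne_top {μ ν ρ : Measure (Rd d)} (h₁ : W2e μ ν ≠ ⊤) (h₂ : W2e ν ρ ≠ ⊤) :
    W2 μ ρ ≤ W2 μ ν + W2 ν ρ := by
  simp only [W2_eq_toReal_W2e]
  rw [← ENNReal.toReal_add h₁ h₂]
  exact ENNReal.toReal_mono (ENNReal.add_ne_top.2 ⟨h₁, h₂⟩) (W2e_triangle _ _ _)

/-- Optimal plans induce constant speed geodesics. -/
theorem W2_inducedCurve_of_optimal (hμ₀ : IsP2 μ₀) (hμ₁ : IsP2 μ₁)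
    (hα : α ∈ optimalPlans μ₀ μ₁) {s t : ℝ} (hs : 0 ≤ s) (hst : s ≤ t) (ht : t ≤ 1) :
    W2 (inducedCurve α s) (inducedCurve α t) = (t - s) * W2 μ₀ μ₁ := by
  have := hα.1.1
  have hW : W2 μ₀ μ₁ = (planCost α).toReal := by rw [W2_eq_toReal_W2e, W2e_eq_planCost hα]
  have hle := W2_inducedCurve_le hμ₀ hμ₁ hα.1
  have hfin : ∀ a b, W2e (inducedCurve α a) (inducedCurve α b) ≠ ⊤ := fun a b =>
    ne_top_of_le_ne_top (ENNReal.mul_ne_top ENNReal.ofReal_ne_top (planCost_ne_top hμ₀ hμ₁ hα.1))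
      (W2e_inducedCurve_le a b)
  -- Going from 0 to 1 through s and t costs at most (s + (t-s) + (1-t)) W₂(μ₀, μ₁), which is
  -- already the full distance; hence none of the three upper bounds can be strict.
  have t1 := W2_triangle_of_ne_top (hfin 0 s) (hfin s 1)
  have t2 := W2_triangle_of_ne_top (hfin s t) (hfin t 1)
  have a1 := hle 0 s
  have a2 := hle s t
  have a3 := hle t 1
  rw [inducedCurve_zero hα.1, inducedCurve_one hα.1, hW] at t1
  rw [inducedCurve_one hα.1] at t2 a3
  rw [inducedCurve_zero hα.1] at a1
  rw [abs_of_nonneg (by linarith)] at a1 a2 a3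
  rw [hW]
  linarith

theorem hasMetricDeriv_of_optimal (hμ₀ : IsP2 μ₀) (hμ₁ : IsP2 μ₁)
    (hα : α ∈ optimalPlans μ₀ μ₁) {t : ℝ} (ht : t ∈ Icc (0 : ℝ) 1) :
    HasMetricDeriv 0 1 (inducedCurve α) t (W2 μ₀ μ₁) := by
  refine tendsto_const_nhds.congr' ?_
  filter_upwards [self_mem_nhdsWithin] with h hh
  obtain ⟨h0, h1, h2⟩ := hh
  rcases lt_or_gt_of_ne h0 with h3 | h3
  -- For h < 0 the times t and t + h are in the wrong order for the geodesic formula.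
  · rw [W2_eq_toReal_W2e (inducedCurve α t), W2e_comm, ← W2_eq_toReal_W2e,
      W2_inducedCurve_of_optimal hμ₀ hμ₁ hα h1 (by linarith) ht.2, abs_of_neg h3]
    field_simp
    ring
  · rw [W2_inducedCurve_of_optimal hμ₀ hμ₁ hα ht.1 (by linarith) h2, abs_of_pos h3]
    field_simp
    ring

theorem narrowlyContinuous_inducedCurve [IsProbabilityMeasure α] (a b : ℝ) :
    NarrowlyContinuous a b (inducedCurve α) := by
  intro f
  refine Continuous.continuousOn ?_
  have h : ∀ t, ∫ x, f x ∂inducedCurve α t = ∫ p, f (interp t p) ∂α := fun t =>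
    integral_map (measurable_interp t).aemeasurable f.continuous.aestronglyMeasurable
  simp_rw [h]
  refine continuous_of_dominated (bound := fun _ => ‖f‖)
    (fun t => (f.continuous.comp (continuous_interp t)).aestronglyMeasurable)
    (fun t => ae_of_all _ fun p => f.norm_coe_le_norm _) (integrable_const _) (ae_of_all _ fun p => ?_)
  exact f.continuous.comp (continuous_uncurry_interp.comp (Continuous.prodMk_left p))

end InducedCurve

/-! ### The L² contraction for densities of push-forwards -/

section L2Norm

theorem MeasureTheory.MemLp.eLpNorm_two_eq_ofReal_sqrt {Ω F : Type*} [MeasurableSpace Ω]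
    [NormedAddCommGroup F] {μ : Measure Ω} {f : Ω → F} (hf : MemLp f 2 μ) :
    eLpNorm f 2 μ = ENNReal.ofReal (√(∫ x, ‖f x‖ ^ 2 ∂μ)) := by
  rw [hf.eLpNorm_eq_integral_rpow_norm two_ne_zero ENNReal.ofNat_ne_top, Real.sqrt_eq_rpow]
  norm_num

theorem integrable_norm_sq {Ω F : Type*} [MeasurableSpace Ω]
    [NormedAddCommGroup F] {μ : Measure Ω} {f : Ω → F} (hf : MemLp f 2 μ) :
    Integrable (fun x => ‖f x‖ ^ 2) μ := (memLp_two_iff_integrable_sq_norm hf.1).1 hf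

theorem integral_norm_sq_comp_of_map_eq {Ω Ω' F : Type*} [MeasurableSpace Ω] [MeasurableSpace Ω']
    [NormedAddCommGroup F] {α : Measure Ω} {γ : Measure Ω'} {f : Ω' → Ω} (hf : Measurable f)
    (h : γ.map f = α) {w : Ω → F} (hw : MemLp w 2 α) :
    MemLp (fun q => w (f q)) 2 γ ∧ ∫ q, ‖w (f q)‖ ^ 2 ∂γ = ∫ p, ‖w p‖ ^ 2 ∂α := by
  subst h
  exact ⟨hw.comp_of_map hf.aemeasurable,
    (integral_map hf.aemeasurable (integrable_norm_sq hw).1).symm⟩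

/-- A density of `e_♯ (w α)` with respect to `e_♯ α` has at most the `L²` norm of `w`. -/
theorem memLp_density {B Ω F : Type*} [MeasurableSpace B] [MeasurableSpace Ω]
    [StandardBorelSpace Ω] [Nonempty Ω] [NormedAddCommGroup F] [InnerProductSpace ℝ F]
    [CompleteSpace F] [MeasurableEq B] {α : Measure Ω} [IsProbabilityMeasure α] {e : Ω → B}
    {w : Ω → F} {v : B → F} (he : Measurable e) (hw : MemLp w 2 α) (hv : Integrable v (α.map e))
    (h : ∀ s, MeasurableSet s → ∫ z in s, v z ∂α.map e = ∫ p in e ⁻¹' s, w p ∂α) :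
    MemLp v 2 (α.map e) ∧ ∫ z, ‖v z‖ ^ 2 ∂α.map e ≤ ∫ p, ‖w p‖ ^ 2 ∂α := by
  obtain ⟨γ, hγ, hf, hs, -, hint, heq⟩ := exists_conditionally_independent_copies he hw hv h
  refine ⟨(memLp_two_iff_integrable_sq_norm hv.1).2 hint, ?_⟩
  obtain ⟨h1, i1⟩ := integral_norm_sq_comp_of_map_eq measurable_fst hf hw
  obtain ⟨h2, i2⟩ := integral_norm_sq_comp_of_map_eq measurable_snd hs hw
  have key : ∫ q, inner ℝ (w q.1) (w q.2) ∂γ ≤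
      ∫ q, (2⁻¹ * ‖w q.1‖ ^ 2 + 2⁻¹ * ‖w q.2‖ ^ 2) ∂γ := by
    refine integral_mono (h1.integrable_real_inner h2)
      (((integrable_norm_sq h1).const_mul _).add ((integrable_norm_sq h2).const_mul _)) fun q => ?_
    have := real_inner_le_norm (w q.1) (w q.2)
    dsimp only
    nlinarith [sq_nonneg (‖w q.1‖ - ‖w q.2‖)]
  rw [integral_add ((integrable_norm_sq h1).const_mul _) ((integrable_norm_sq h2).const_mul _),
    integral_const_mul, integral_const_mul, i1, i2, heq] at key
  linarith

end L2Norm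

/-! ### Kinetic energy and time measurability of the velocity -/

section Velocity

variable {d : ℕ} {μ₀ μ₁ : Measure (Rd d)} {α : Measure (Rd d × Rd d)} {v : ℝ → Rd d → Rd d}

/-- The equality of vector measures is evaluated on Borel sets. Both densities must be integrable,
since `withDensityᵥ` is zero otherwise. -/
theorem IsInducedVelocity.ae_setIntegral_eq (hv : IsInducedVelocity α v)
    (hw : Integrable (fun p : Rd d × Rd d => p.2 - p.1) α) :
    ∀ᵐ t ∂volume.restrict (Icc (0 : ℝ) 1), Integrable (v t) (α.map (interp t)) ∧
      ∀ s, MeasurableSet s →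
        ∫ z in s, v t z ∂α.map (interp t) = ∫ p in interp t ⁻¹' s, (p.2 - p.1) ∂α := by
  filter_upwards [hv.integrable, hv.density_eq] with t h1 h2
  refine ⟨h1, fun s hs => ?_⟩
  have h := congrArg (fun m => m s) h2
  rwa [withDensityᵥ_apply h1 hs, VectorMeasure.map_apply _ (measurable_interp t) hs,
    withDensityᵥ_apply hw (measurable_interp t hs)] at h

theorem IsInducedVelocity.ae_memLp (hv : IsInducedVelocity α v) [IsProbabilityMeasure α]
    (hw : MemLp (fun p : Rd d × Rd d => p.2 - p.1) 2 α) :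
    ∀ᵐ t ∂volume.restrict (Icc (0 : ℝ) 1), MemLp (v t) 2 (inducedCurve α t) ∧
      ∫ x, ‖v t x‖ ^ 2 ∂inducedCurve α t ≤ ∫ p, ‖p.2 - p.1‖ ^ 2 ∂α := by
  filter_upwards [hv.ae_setIntegral_eq (hw.integrable (by norm_num))] with t ht
  exact memLp_density (measurable_interp t) hw ht.1 ht.2

/-- For an optimal plan and `0 < t < 1`, the induced velocity has full kinetic energy. -/
theorem integral_norm_sq_velocity_of_optimal (hα : α ∈ optimalPlans μ₀ μ₁)
    (hw : MemLp (fun p : Rd d × Rd d => p.2 - p.1) 2 α) {t : ℝ} (ht0 : 0 < t) (ht1 : t < 1)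
    {u : Rd d → Rd d} (hu : Integrable u (α.map (interp t)))
    (h : ∀ s, MeasurableSet s →
      ∫ z in s, u z ∂α.map (interp t) = ∫ p in interp t ⁻¹' s, (p.2 - p.1) ∂α) :
    ∫ p, ‖p.2 - p.1‖ ^ 2 ∂α ≤ ∫ z, ‖u z‖ ^ 2 ∂α.map (interp t) := by
  have := hα.1.1
  obtain ⟨γ, hγ, hf, hs, hq, -, heq⟩ :=
    exists_conditionally_independent_copies (measurable_interp t) hw hu h
  obtain ⟨h1, i1⟩ := integral_norm_sq_comp_of_map_eq measurable_fst hf hw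
  obtain ⟨h2, i2⟩ := integral_norm_sq_comp_of_map_eq measurable_snd hs hw
  -- The competitor starts where the first copy starts and ends where the second one ends.
  have hc : γ.map (fun q => (q.1.1, q.2.2)) ∈ couplings μ₀ μ₁ := by
    refine ⟨Measure.isProbabilityMeasure_map (by fun_prop), ?_, ?_⟩
    · rw [Measure.map_map measurable_fst (by fun_prop), ← hα.1.2.1]
      conv_rhs => rw [← hf, Measure.map_map measurable_fst measurable_fst]
      rfl
    · rw [Measure.map_map measurable_snd (by fun_prop), ← hα.1.2.2]
      conv_rhs => rw [← hs, Measure.map_map measurable_snd measurable_snd]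
      rfl
  have hle := hα.2 _ hc
  have hmem : MemLp (fun q : (Rd d × Rd d) × (Rd d × Rd d) =>
      t • (q.1.2 - q.1.1) + (1 - t) • (q.2.2 - q.2.1)) 2 γ :=
    (h1.const_smul t).add (h2.const_smul (1 - t))
  -- The copies agree at time t, so y₂ - x₁ is the first displacement run for time t plus the second
  -- run for time 1 - t.
  have hcost : planCost (γ.map fun q => (q.1.1, q.2.2)) =
      eLpNorm (fun q : (Rd d × Rd d) × (Rd d × Rd d) =>
        t • (q.1.2 - q.1.1) + (1 - t) • (q.2.2 - q.2.1)) 2 γ := by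
    rw [planCost_map (by fun_prop), ← eLpNorm_neg]
    refine eLpNorm_congr_ae ?_
    filter_upwards [hq] with q hq
    simp only [interp] at hq
    have : (1 - t) • q.2.1 = (1 - t) • q.1.1 + t • q.1.2 - t • q.2.2 := by rw [hq]; module
    simp only [Pi.neg_apply]
    rw [smul_sub (1 - t), this]
    module
  rw [planCost_eq_eLpNorm_displacement, hcost, hw.eLpNorm_two_eq_ofReal_sqrt,
    hmem.eLpNorm_two_eq_ofReal_sqrt, ENNReal.ofReal_le_ofReal_iff (Real.sqrt_nonneg _),
    Real.sqrt_le_sqrt_iff (integral_nonneg fun _ => by positivity)] at hle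
  have hexp : ∀ q : (Rd d × Rd d) × (Rd d × Rd d),
      ‖t • (q.1.2 - q.1.1) + (1 - t) • (q.2.2 - q.2.1)‖ ^ 2 =
        t ^ 2 * ‖q.1.2 - q.1.1‖ ^ 2 + (1 - t) ^ 2 * ‖q.2.2 - q.2.1‖ ^ 2 +
          2 * t * (1 - t) * inner ℝ (q.1.2 - q.1.1) (q.2.2 - q.2.1) := fun q => by
    rw [norm_add_sq_real, norm_smul, norm_smul, inner_smul_left, inner_smul_right, mul_pow,
      mul_pow, Real.norm_eq_abs, Real.norm_eq_abs, sq_abs, sq_abs]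
    simp only [conj_trivial]
    ring
  have j1 := (integrable_norm_sq h1).const_mul (t ^ 2)
  have j2 := (integrable_norm_sq h2).const_mul ((1 - t) ^ 2)
  have j3 := (h1.integrable_real_inner h2).const_mul (2 * t * (1 - t))
  have j12 : Integrable (fun q : (Rd d × Rd d) × (Rd d × Rd d) =>
      t ^ 2 * ‖q.1.2 - q.1.1‖ ^ 2 + (1 - t) ^ 2 * ‖q.2.2 - q.2.1‖ ^ 2) γ := j1.add j2
  rw [integral_congr_ae (ae_of_all _ hexp), integral_add j12 j3, integral_add j1 j2,
    integral_const_mul, integral_const_mul, integral_const_mul, i1, i2, heq] at hle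
  -- Since 1 - t² - (1-t)² = 2t(1-t), this factor appears on both sides of the cost comparison;
  -- dividing by it is where 0 < t < 1 is used.
  have hpos : 0 < 2 * t * (1 - t) := by have := sub_pos.2 ht1; positivity
  refine le_of_mul_le_mul_left ?_ hpos
  linarith

/-- The extension of the velocity to all times that is constant outside `[0, 1]`. -/
theorem MeasurableField.measurable_projIcc (hv : MeasurableField 0 1 v) :
    Measurable fun q : ℝ × Rd d => v (projIcc (0 : ℝ) 1 zero_le_one q.1) q.2 :=
  Measurable.comp (g := fun p : Icc (0 : ℝ) 1 × Rd d => v p.1 p.2) hv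
    (f := fun q : ℝ × Rd d => (projIcc (0 : ℝ) 1 zero_le_one q.1, q.2))
    ((continuous_projIcc.measurable.comp measurable_fst).prodMk measurable_snd)

/-- Integrals along the curve of a jointly measurable function of `(t, x, v_t(x))` are measurable
in time. -/
theorem aestronglyMeasurable_integral_velocity (hv : IsInducedVelocity α v)
    [IsProbabilityMeasure α] {G : ℝ × Rd d × Rd d → ℝ} (hG : Continuous G) :
    AEStronglyMeasurable (fun t => ∫ x, G (t, x, v t x) ∂inducedCurve α t)
      (volume.restrict (Icc (0 : ℝ) 1)) := by
  -- Pulled back to the fixed measure α, the integral has its time dependence only in the integrand.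
  -- Time is clamped because v is measurable only over [0, 1].
  have hm : StronglyMeasurable fun q : ℝ × (Rd d × Rd d) =>
      G (q.1, interp q.1 q.2, v (projIcc (0 : ℝ) 1 zero_le_one q.1) (interp q.1 q.2)) := by
    have hi : Measurable fun q : ℝ × (Rd d × Rd d) => interp q.1 q.2 :=
      continuous_uncurry_interp.measurable
    exact (hG.measurable.comp (measurable_fst.prodMk (hi.prodMk
      (hv.measurable.measurable_projIcc.comp (measurable_fst.prodMk hi))))).stronglyMeasurable
  refine (hm.integral_prod_right' (ν := α)).aestronglyMeasurable.congr ?_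
  filter_upwards [ae_restrict_mem measurableSet_Icc, hv.integrable] with t ht hvt
  rw [inducedCurve, integral_map (measurable_interp t).aemeasurable]
  · simp only [projIcc_of_mem zero_le_one ht]
  · exact hG.comp_aestronglyMeasurable
      (aestronglyMeasurable_const.prodMk (aestronglyMeasurable_id.prodMk hvt.1))

end Velocity

/-! ### The continuity equation -/

section ContinuityEquation

variable {d : ℕ} {μ₀ μ₁ : Measure (Rd d)} {α : Measure (Rd d × Rd d)} {v : ℝ → Rd d → Rd d}
  {φ : ℝ × Rd d → ℝ} {a b : ℝ}

theorem IsTestFunction.hasFDerivAt (hφ : IsTestFunction a b φ) (q : ℝ × Rd d) :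
    HasFDerivAt φ (fderiv ℝ φ q) q :=
  (hφ.contDiff.differentiable (by simp) q).hasFDerivAt

theorem IsTestFunction.continuous_fderiv (hφ : IsTestFunction a b φ) :
    Continuous (fderiv ℝ φ) := hφ.contDiff.continuous_fderiv (by simp)

theorem IsTestFunction.exists_bound (hφ : IsTestFunction a b φ) :
    ∃ K, ∀ q, ‖fderiv ℝ φ q‖ ≤ K :=
  (hφ.hasCompactSupport.fderiv (𝕜 := ℝ)).exists_bound_of_continuous hφ.continuous_fderiv

theorem IsTestFunction.deriv_time (hφ : IsTestFunction a b φ) (t : ℝ) (x : Rd d) :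
    deriv (fun s => φ (s, x)) t = fderiv ℝ φ (t, x) (1, 0) :=
  ((hφ.hasFDerivAt (t, x)).comp_hasDerivAt t
    ((hasDerivAt_id t).prodMk (hasDerivAt_const t x))).deriv

theorem IsTestFunction.gradient_space (hφ : IsTestFunction a b φ) (t : ℝ) (x : Rd d) :
    gradient (fun z => φ (t, z)) x = (InnerProductSpace.toDual ℝ (Rd d)).symm
      ((fderiv ℝ φ (t, x)).comp (ContinuousLinearMap.inr ℝ ℝ (Rd d))) := by
  have h : HasFDerivAt (fun z => φ (t, z))
      ((fderiv ℝ φ (t, x)).comp (ContinuousLinearMap.inr ℝ ℝ (Rd d))) x :=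
    (hφ.hasFDerivAt (t, x)).comp x (hasFDerivAt_prodMk_right t x)
  rw [gradient, h.fderiv]

theorem IsTestFunction.inner_gradient_space (hφ : IsTestFunction a b φ) (t : ℝ) (x y : Rd d) :
    inner ℝ (gradient (fun z => φ (t, z)) x) y = fderiv ℝ φ (t, x) (0, y) := by
  rw [hφ.gradient_space, InnerProductSpace.toDual_symm_apply]
  rfl

theorem IsTestFunction.continuous_gradient_space (hφ : IsTestFunction a b φ) (t : ℝ) :
    Continuous (gradient fun z => φ (t, z)) := by
  have h : gradient (fun z => φ (t, z)) = fun x => (InnerProductSpace.toDual ℝ (Rd d)).symm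
      ((fderiv ℝ φ (t, x)).comp (ContinuousLinearMap.inr ℝ ℝ (Rd d))) :=
    funext (hφ.gradient_space t)
  rw [h]
  exact (LinearIsometryEquiv.continuous _).comp
    ((hφ.continuous_fderiv.comp (Continuous.prodMk_right t)).clm_comp continuous_const)

theorem IsTestFunction.norm_gradient_space_le (hφ : IsTestFunction a b φ) {K : ℝ}
    (hK : ∀ q, ‖fderiv ℝ φ q‖ ≤ K) (t : ℝ) (x : Rd d) :
    ‖gradient (fun z => φ (t, z)) x‖ ≤ K := by
  rw [hφ.gradient_space, LinearIsometryEquiv.norm_map]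
  refine (ContinuousLinearMap.opNorm_comp_le _ _).trans ?_
  refine (mul_le_of_le_one_right (norm_nonneg _) ?_).trans (hK (t, x))
  exact ContinuousLinearMap.norm_inr_le_one ℝ ℝ (Rd d)

/-- As one space-time derivative in the direction (1, v), the integrand has the same form as the
derivative of φ along a segment. -/
theorem IsTestFunction.ceIntegrand_eq (hφ : IsTestFunction a b φ) (t : ℝ) (x : Rd d) :
    ceIntegrand v φ t x = fderiv ℝ φ (t, x) (1, v t x) := by
  rw [ceIntegrand, hφ.deriv_time, hφ.inner_gradient_space, ← map_add]
  simp

theorem norm_apply_one_le {K : ℝ} {L : ℝ × Rd d →L[ℝ] ℝ} (hL : ‖L‖ ≤ K) (y : Rd d) :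
    ‖L (1, y)‖ ≤ K * (1 + ‖y‖) := by
  have hK := (norm_nonneg _).trans hL
  refine (L.le_of_opNorm_le hL _).trans (mul_le_mul_of_nonneg_left ?_ hK)
  rw [Prod.norm_mk, norm_one]
  exact max_le (by linarith [norm_nonneg y]) (by linarith)

theorem IsTestFunction.integrable_ceIntegrand (hφ : IsTestFunction a b φ) {t : ℝ}
    {μ : Measure (Rd d)} [IsProbabilityMeasure μ] (hv : Integrable (v t) μ) :
    Integrable (ceIntegrand v φ t) μ := by
  obtain ⟨K, hK⟩ := hφ.exists_bound
  have heq : ceIntegrand v φ t = fun x => fderiv ℝ φ (t, x) (1, v t x) :=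
    funext (hφ.ceIntegrand_eq t)
  rw [heq]
  refine (((integrable_const (1 : ℝ)).add hv.norm).const_mul K).mono' ?_
    (ae_of_all _ fun x => norm_apply_one_le (hK _) _)
  have hc : Continuous fun q : Rd d × Rd d => fderiv ℝ φ (t, q.1) (1, q.2) := by
    have := hφ.continuous_fderiv
    fun_prop
  exact hc.comp_aestronglyMeasurable (aestronglyMeasurable_id.prodMk hv.1)

theorem IsTestFunction.hasDerivAt_along (hφ : IsTestFunction a b φ) (p : Rd d × Rd d) (t : ℝ) :
    HasDerivAt (fun s => φ (s, interp s p)) (fderiv ℝ φ (t, interp t p) (1, p.2 - p.1)) t := by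
  have h : HasDerivAt (fun s => interp s p) (p.2 - p.1) t := by
    have h1 := (((hasDerivAt_id t).const_sub 1).smul_const p.1).add
      ((hasDerivAt_id t).smul_const p.2)
    refine h1.congr_deriv ?_
    module
  exact (hφ.hasFDerivAt _).comp_hasDerivAt t ((hasDerivAt_id t).prodMk h)

theorem IsTestFunction.eq_zero_of_notMem (hφ : IsTestFunction a b φ) {t : ℝ} (ht : t ∉ Ioo a b)
    (x : Rd d) : φ (t, x) = 0 := by
  by_contra h
  exact ht (hφ.tsupport_subset (subset_tsupport φ h)).1

/-- The integrand is the time derivative of φ along the segment, and φ vanishes at both end times.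
-/
theorem IsTestFunction.integral_along_eq_zero (hφ : IsTestFunction 0 1 φ) (p : Rd d × Rd d) :
    ∫ t in Icc (0 : ℝ) 1, fderiv ℝ φ (t, interp t p) (1, p.2 - p.1) = 0 := by
  rw [integral_Icc_eq_integral_Ioc, ← intervalIntegral.integral_of_le zero_le_one,
    intervalIntegral.integral_eq_sub_of_hasDerivAt (fun t _ => hφ.hasDerivAt_along p t),
    hφ.eq_zero_of_notMem (by simp), hφ.eq_zero_of_notMem (by simp), sub_zero]
  refine Continuous.intervalIntegrable ?_ _ _
  have h1 := hφ.continuous_fderiv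
  have h2 : Continuous fun t => interp t p :=
    continuous_uncurry_interp.comp (Continuous.prodMk_left p)
  fun_prop

theorem integrable_along (hφ : IsTestFunction a b φ) [IsProbabilityMeasure α]
    (hw : Integrable (fun p : Rd d × Rd d => p.2 - p.1) α) :
    Integrable (fun q : ℝ × (Rd d × Rd d) =>
      fderiv ℝ φ (q.1, interp q.1 q.2) (1, q.2.2 - q.2.1))
      ((volume.restrict (Icc (0 : ℝ) 1)).prod α) := by
  obtain ⟨K, hK⟩ := hφ.exists_bound
  have hbound : Integrable (fun q : ℝ × (Rd d × Rd d) => K * (1 + ‖q.2.2 - q.2.1‖))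
      ((volume.restrict (Icc (0 : ℝ) 1)).prod α) :=
    (((integrable_const (1 : ℝ)).add hw.norm).const_mul K).comp_snd _
  refine hbound.mono' (Continuous.aestronglyMeasurable ?_)
    (ae_of_all _ fun q => norm_apply_one_le (hK _) _)
  have h1 := hφ.continuous_fderiv
  have h2 := continuous_uncurry_interp (d := d)
  fun_prop

/-- Replaces the Eulerian velocity by the particle displacement: the time part is a change of
variables, the spatial part tests v_t μ_t against the bounded field ∇φ(t, ·). -/
theorem integral_ceIntegrand_eq (hφ : IsTestFunction a b φ) [IsProbabilityMeasure α]
    (hw : Integrable (fun p : Rd d × Rd d => p.2 - p.1) α) {t : ℝ}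
    (hv : Integrable (v t) (α.map (interp t)))
    (h : ∀ s, MeasurableSet s →
      ∫ z in s, v t z ∂α.map (interp t) = ∫ p in interp t ⁻¹' s, (p.2 - p.1) ∂α) :
    ∫ x, ceIntegrand v φ t x ∂inducedCurve α t =
      ∫ p, fderiv ℝ φ (t, interp t p) (1, p.2 - p.1) ∂α := by
  obtain ⟨K, hK⟩ := hφ.exists_bound
  have hme := measurable_interp (d := d) t
  have := isProbabilityMeasure_inducedCurve (α := α) t
  have hg := hφ.continuous_gradient_space t
  have hgb := hφ.norm_gradient_space_le hK t
  have hgrad := integral_inner_density hme hw hv h hg.stronglyMeasurable hgb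
  have hc : Continuous fun x => fderiv ℝ φ (t, x) ((1 : ℝ), (0 : Rd d)) := by
    have := hφ.continuous_fderiv
    fun_prop
  have hb : ∀ x, ‖fderiv ℝ φ (t, x) ((1 : ℝ), (0 : Rd d))‖ ≤ K := fun x => by
    simpa using norm_apply_one_le (hK (t, x)) (0 : Rd d)
  have hi1 : Integrable (fun x => fderiv ℝ φ (t, x) ((1 : ℝ), (0 : Rd d))) (inducedCurve α t) :=
    (integrable_const K).mono' hc.aestronglyMeasurable (ae_of_all _ hb)
  have hi1' : Integrable (fun p => fderiv ℝ φ (t, interp t p) ((1 : ℝ), (0 : Rd d))) α :=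
    hi1.comp_measurable hme
  have hi2 : Integrable (fun x => (inner ℝ (gradient (fun z => φ (t, z)) x) (v t x) : ℝ))
      (inducedCurve α t) :=
    (hv.norm.const_mul K).mono' (hg.aestronglyMeasurable.inner hv.1) <| ae_of_all _ fun x =>
      (norm_inner_le_norm _ _).trans (mul_le_mul_of_nonneg_right (hgb x) (norm_nonneg _))
  have hi3 : Integrable (fun p : Rd d × Rd d =>
      (inner ℝ (gradient (fun z => φ (t, z)) (interp t p)) (p.2 - p.1) : ℝ)) α :=
    (hw.norm.const_mul K).mono'
      ((hg.comp (continuous_interp t)).aestronglyMeasurable.inner hw.1) <| ae_of_all _ fun p =>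
      (norm_inner_le_norm _ _).trans (mul_le_mul_of_nonneg_right (hgb _) (norm_nonneg _))
  simp only [ceIntegrand, hφ.deriv_time]
  rw [integral_add hi1 hi2]
  change _ + ∫ x, inner ℝ (gradient (fun z => φ (t, z)) x) (v t x) ∂α.map (interp t) = _
  rw [hgrad, inducedCurve, integral_map hme.aemeasurable hc.aestronglyMeasurable,
    ← integral_add hi1' hi3]
  refine integral_congr_ae (ae_of_all _ fun p => ?_)
  simp only [hφ.inner_gradient_space]
  rw [← map_add]
  simp

/-- A plan with finite second moments and its induced velocity solve the continuity equation. -/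
theorem satisfiesCE_inducedCurve (hμ₀ : IsP2 μ₀) (hμ₁ : IsP2 μ₁) (hα : α ∈ couplings μ₀ μ₁)
    (hv : IsInducedVelocity α v) : SatisfiesCE 0 1 (inducedCurve α) v := by
  have := hα.1
  have hw2 := memLp_displacement hμ₀ hμ₁ hα
  have hw := hw2.integrable (by norm_num)
  refine ⟨fun t _ => isP2_inducedCurve hμ₀ hμ₁ hα t, narrowlyContinuous_inducedCurve 0 1,
    hv.measurable, fun φ hφ => ?_, fun φ hφ => ?_, fun φ hφ => ?_⟩
  · filter_upwards [hv.integrable] with t ht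
    have := isProbabilityMeasure_inducedCurve (α := α) t
    exact hφ.integrable_ceIntegrand ht
  · obtain ⟨K, hK⟩ := hφ.exists_bound
    have hK0 : 0 ≤ K := (norm_nonneg _).trans (hK 0)
    have hm : AEStronglyMeasurable (fun t => ∫ x, ‖ceIntegrand v φ t x‖ ∂inducedCurve α t)
        (volume.restrict (Icc (0 : ℝ) 1)) := by
      simp only [hφ.ceIntegrand_eq]
      refine aestronglyMeasurable_integral_velocity hv
        (G := fun q => ‖fderiv ℝ φ (q.1, q.2.1) (1, q.2.2)‖) ?_
      have h1 := hφ.continuous_fderiv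
      fun_prop
    -- The pointwise bound K(1 + |v|) is relaxed to K(2 + |v|²), so that the uniform kinetic energy
    -- bound gives a constant majorant in t.
    refine (integrable_const (K * (2 + ∫ p, ‖p.2 - p.1‖ ^ 2 ∂α))).mono' hm ?_
    filter_upwards [hv.integrable, hv.ae_memLp hw2] with t ht ht2
    have := isProbabilityMeasure_inducedCurve (α := α) t
    rw [Real.norm_of_nonneg (integral_nonneg fun _ => norm_nonneg _)]
    have hsq := integrable_norm_sq ht2.1
    have hle : ∫ x, ‖ceIntegrand v φ t x‖ ∂inducedCurve α t ≤
        ∫ x, K * (2 + ‖v t x‖ ^ 2) ∂inducedCurve α t := by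
      refine integral_mono (hφ.integrable_ceIntegrand ht).norm
        (((integrable_const _).add hsq).const_mul K) fun x => ?_
      dsimp only
      rw [hφ.ceIntegrand_eq]
      refine (norm_apply_one_le (hK _) _).trans (mul_le_mul_of_nonneg_left ?_ hK0)
      nlinarith [sq_nonneg (‖v t x‖ - 1), norm_nonneg (v t x)]
    refine hle.trans ?_
    rw [integral_const_mul, integral_add (integrable_const _) hsq]
    refine mul_le_mul_of_nonneg_left ?_ hK0
    simpa using ht2.2
  · have h1 : ∫ t in Icc (0 : ℝ) 1, ∫ x, ceIntegrand v φ t x ∂inducedCurve α t =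
        ∫ t in Icc (0 : ℝ) 1, ∫ p, fderiv ℝ φ (t, interp t p) (1, p.2 - p.1) ∂α := by
      refine integral_congr_ae ?_
      filter_upwards [hv.ae_setIntegral_eq hw] with t ht
      exact integral_ceIntegrand_eq hφ hw ht.1 ht.2
    rw [h1, integral_integral_swap (integrable_along hφ hw)]
    simp [hφ.integral_along_eq_zero]

end ContinuityEquation

/-! ### The main theorem -/

theorem mainTheorem1 (d : ℕ) (μ₀ μ₁ : Measure (Rd d)) (hμ₀ : IsP2 μ₀) (hμ₁ : IsP2 μ₁)
    (α : Measure (Rd d × Rd d)) (hα : α ∈ couplings μ₀ μ₁)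
    (v : ℝ → Rd d → Rd d) (hv : IsInducedVelocity α v) :
    (SatisfiesCE 0 1 (inducedCurve α) v ∧
      MemLp (fun p : Rd d × Rd d => p.2 - p.1) 2 α ∧
      (∀ᵐ t ∂volume.restrict (Icc (0 : ℝ) 1),
        MemLp (v t) 2 (inducedCurve α t) ∧
        eLpNorm (v t) 2 (inducedCurve α t) ≤
          eLpNorm (fun p : Rd d × Rd d => p.2 - p.1) 2 α) ∧
      IntegrableOn (fun t => (eLpNorm (v t) 2 (inducedCurve α t)).toReal) (Icc (0 : ℝ) 1) ∧
      IsACCurve 0 1 (inducedCurve α)) ∧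
    (α ∈ optimalPlans μ₀ μ₁ →
      (∀ t h : ℝ, 0 ≤ t → 0 ≤ h → t + h ≤ 1 →
        W2 (inducedCurve α t) (inducedCurve α (t + h)) = h * W2 μ₀ μ₁) ∧
      (∀ᵐ t ∂volume.restrict (Icc (0 : ℝ) 1),
        HasMetricDeriv 0 1 (inducedCurve α) t (W2 μ₀ μ₁) ∧
        eLpNorm (v t) 2 (inducedCurve α t) = ENNReal.ofReal (W2 μ₀ μ₁))) := by
  have := hα.1
  have hw := memLp_displacement hμ₀ hμ₁ hα
  have hbound : ∀ᵐ t ∂volume.restrict (Icc (0 : ℝ) 1), MemLp (v t) 2 (inducedCurve α t) ∧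
      eLpNorm (v t) 2 (inducedCurve α t) ≤
        eLpNorm (fun p : Rd d × Rd d => p.2 - p.1) 2 α := by
    filter_upwards [hv.ae_memLp hw] with t ht
    refine ⟨ht.1, ?_⟩
    rw [ht.1.eLpNorm_two_eq_ofReal_sqrt, hw.eLpNorm_two_eq_ofReal_sqrt]
    exact ENNReal.ofReal_le_ofReal (Real.sqrt_le_sqrt ht.2)
  refine ⟨⟨satisfiesCE_inducedCurve hμ₀ hμ₁ hα hv, hw, hbound, ?_,
    isACCurve_inducedCurve hμ₀ hμ₁ hα⟩, fun hopt => ⟨fun t h ht hh hth => ?_, ?_⟩⟩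
  · have hm := aestronglyMeasurable_integral_velocity hv (G := fun q => ‖q.2.2‖ ^ 2) (by fun_prop)
    have hm' : AEStronglyMeasurable (fun t => (eLpNorm (v t) 2 (inducedCurve α t)).toReal)
        (volume.restrict (Icc (0 : ℝ) 1)) := by
      refine (Real.continuous_sqrt.comp_aestronglyMeasurable hm).congr ?_
      filter_upwards [hbound] with t ht
      rw [ht.1.eLpNorm_two_eq_ofReal_sqrt, ENNReal.toReal_ofReal (Real.sqrt_nonneg _)]
    refine (integrable_const
      (eLpNorm (fun p : Rd d × Rd d => p.2 - p.1) 2 α).toReal).mono' hm' ?_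
    filter_upwards [hbound] with t ht
    rw [Real.norm_of_nonneg ENNReal.toReal_nonneg]
    exact ENNReal.toReal_mono hw.2.ne ht.2
  · rw [W2_inducedCurve_of_optimal hμ₀ hμ₁ hopt ht (by linarith) hth, add_sub_cancel_left]
  · have hW : ENNReal.ofReal (W2 μ₀ μ₁) =
        eLpNorm (fun p : Rd d × Rd d => p.2 - p.1) 2 α := by
      rw [W2_eq_toReal_W2e, W2e_eq_planCost hopt,
        ENNReal.ofReal_toReal (planCost_ne_top hμ₀ hμ₁ hα), planCost_eq_eLpNorm_displacement]
    -- The endpoints are discarded as a null set: there the factor 2t(1-t) of the energy comparison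
    -- vanishes.
    have h0 : ∀ᵐ t ∂volume.restrict (Icc (0 : ℝ) 1), t ≠ 0 :=
      ae_restrict_of_ae (Measure.ae_ne volume 0)
    have h1 : ∀ᵐ t ∂volume.restrict (Icc (0 : ℝ) 1), t ≠ 1 :=
      ae_restrict_of_ae (Measure.ae_ne volume 1)
    filter_upwards [hbound, hv.ae_setIntegral_eq (hw.integrable (by norm_num)), h0, h1,
      ae_restrict_mem measurableSet_Icc] with t hb hs ht0 ht1 ht
    refine ⟨hasMetricDeriv_of_optimal hμ₀ hμ₁ hopt ht, ?_⟩
    rw [hW]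
    refine le_antisymm hb.2 ?_
    rw [hb.1.eLpNorm_two_eq_ofReal_sqrt, hw.eLpNorm_two_eq_ofReal_sqrt]
    exact ENNReal.ofReal_le_ofReal (Real.sqrt_le_sqrt (integral_norm_sq_velocity_of_optimal hopt hw
      (lt_of_le_of_ne ht.1 ht0.symm) (lt_of_le_of_ne ht.2 ht1) hs.1 hs.2))
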